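/- **Setting.** A bin packing instance is a finite list $I$ of item sizes in $(0,1]$. A bin packing algorithm $A$ assigns to every $I$ a packing of its items into nonempty bins of capacity $1$; $A(I)$ is the number of bins it uses and $OPT(I)$ is the minimum number of bins. A strip packing instance is a finite list $L$ of rectangles with widths and heights in $(0,1]$, which have to be placed, without rotation and with disjoint interiors, in the strip $[0,1]\times[0,\infty)$; $OPT(L)$ is the minimum height of the strip needed, and $B(L)$ is the height used by a strip packing algorithm $B$. For an algorithm $B$ for either problem the asymptotic worst-case ratio is $$R_B^\infty=\limsup_{n\to\infty}\ \sup_L\{B(L)/OPT(L) : OPT(L)=n\}\in[0,\infty].$$ **The algorithm.** Given a bin packing algorithm $A$ and a constant $c>1$, the algorithm $B\&P_{A,c}$ works on $L$ as follows. It sorts the rectangles by nonincreasing width and stacks them in this order, by Next Fit, into slips of height $c$: a rectangle is put on top of the current slip if the total height of that slip stays at most $c$, and otherwise the current slip is closed and the rectangle opens a new one. The width of a slip is the width of its first rectangle. All slips but the last one are then packed by $A$ as one-dimensional items of size equal to their widths, in order of nonincreasing width, each bin becoming a layer of height $c$ of the strip. The last slip is put on top of all layers. **Theorem 2.** Let $A$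 be any offline bin packing algorithm. For every $c>1$ and every $L$, $B\&P_{A,c}$ produces a feasible strip packing of $L$. Moreover $$\limsup_{c\to\infty} R_{B\&P_{A,c}}^\infty\le R_A^\infty ,$$ and if the number of bins used by $A$ depends only on the multiset of the items, not on the order in which they are listed, then $$\lim_{c\to\infty} R_{B\&P_{A,c}}^\infty=R_A^\infty .$$ -/

import Mathlib

open Filter Topology
open scoped ENNReal

/-- Item sizes, and widths and heights of rectangles: real numbers in `(0, 1]`. -/
abbrev Size : Type := Set.Ioc (0 : ℝ) 1

/-! ### Asymptotic worst-case ratio -/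

/-- `limsup_{n → ∞} sup {cost L / opt L : opt L = n}` over all instances `L`, as an extended
nonnegative real. Here `n` runs through the reals, because optimal strip heights are reals. A value
`n` that is the optimum of no instance contributes `0`, so when all optima are natural numbers this
is the limit superior along the natural numbers. -/
noncomputable def asymptoticRatio {ι : Type} (cost opt : ι → ℝ) : ℝ≥0∞ :=
  limsup (fun n : ℝ => ⨆ (L : ι) (_ : opt L = n), ENNReal.ofReal (cost L / opt L)) atTop

/-! ### Bin packing -/

/-- A packing of the items `l` into `numBins` nonempty bins of capacity `1`. -/
structure BinPacking (l : List Size) where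
  numBins : ℕ
  bin : Fin l.length → Fin numBins
  bin_surjective : Function.Surjective bin
  capacity : ∀ b : Fin numBins,
    ∑ k ∈ Finset.univ.filter (fun k => bin k = b), (l.get k : ℝ) ≤ 1

/-- The minimum number of bins into which the items `l` can be packed. -/
noncomputable def binOPT (l : List Size) : ℕ :=
  sInf {m : ℕ | ∃ P : BinPacking l, P.numBins = m}

/-- An offline bin packing algorithm: it sees the whole input and returns a packing of it. -/
abbrev BinPackingAlgorithm : Type := (l : List Size) → BinPacking l

/-- The number of bins used does not depend on the order in which the items are listed, i.e. it is
a function of the multiset of items. -/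
def BinPackingAlgorithm.OrderIndependent (A : BinPackingAlgorithm) : Prop :=
  ∀ l₁ l₂ : List Size, l₁.Perm l₂ → (A l₁).numBins = (A l₂).numBins

/-- The asymptotic worst-case ratio of a bin packing algorithm. -/
noncomputable def BinPackingAlgorithm.ratio (A : BinPackingAlgorithm) : ℝ≥0∞ :=
  asymptoticRatio (fun l : List Size => ((A l).numBins : ℝ)) (fun l => (binOPT l : ℝ))

/-! ### Strip packing -/

structure Rect where
  width : Size
  height : Size

/-- A rectangle together with the position `(x, y)` of its lower left corner. -/
structure PlacedRect where
  rect : Rect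
  x : ℝ
  y : ℝ

namespace PlacedRect

def right (p : PlacedRect) : ℝ := p.x + p.rect.width

def top (p : PlacedRect) : ℝ := p.y + p.rect.height

/-- The rectangle lies in the strip `[0, 1] × [0, ∞)`. -/
def InStrip (p : PlacedRect) : Prop := 0 ≤ p.x ∧ p.right ≤ 1 ∧ 0 ≤ p.y

/-- The interiors of the two placed rectangles are disjoint. -/
def NonOverlapping (p q : PlacedRect) : Prop :=
  p.right ≤ q.x ∨ q.right ≤ p.x ∨ p.top ≤ q.y ∨ q.top ≤ p.y

end PlacedRect

/-- `P` is a packing of exactly the rectangles `L` (each as often as it is listed) into the strip,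
without rotation. -/
structure IsStripPacking (L : List Rect) (P : List PlacedRect) : Prop where
  perm : (P.map PlacedRect.rect).Perm L
  inStrip : ∀ p ∈ P, p.InStrip
  nonOverlapping : P.Pairwise PlacedRect.NonOverlapping

/-- The height of the strip that is used: the largest top edge (`0` if nothing is placed). -/
noncomputable def packingHeight (P : List PlacedRect) : ℝ :=
  (P.map PlacedRect.top).foldr max 0

/-- The optimal strip height. -/
noncomputable def stripOPT (L : List Rect) : ℝ :=
  sInf {H : ℝ | ∃ P : List PlacedRect, IsStripPacking L P ∧ packingHeight P = H}

/-- The asymptotic worst-case ratio of a procedure `B` that places the rectangles of a list. -/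
noncomputable def stripRatio (B : List Rect → List PlacedRect) : ℝ≥0∞ :=
  asymptoticRatio (fun L : List Rect => packingHeight (B L)) stripOPT

/-! ### The algorithm batch-and-pack -/

/-- A nonempty vertical stack of rectangles: `first` at the bottom, then `rest` in order. -/
structure Slip where
  first : Rect
  rest : List Rect

namespace Slip

def rects (s : Slip) : List Rect := s.first :: s.rest

/-- The width of a slip is the width of its first rectangle. -/
def width (s : Slip) : Size := s.first.width

/-- The total height of the rectangles packed in the slip. -/
def packedHeight (s : Slip) : ℝ := (s.rects.map (fun r => (r.height : ℝ))).sum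

def push (s : Slip) (r : Rect) : Slip := ⟨s.first, s.rest ++ [r]⟩

end Slip

/-- Next Fit in the vertical direction with slips of height `c`. The first argument is the slip that
is open. The result is the list of the slips that get closed, and the last slip. -/
noncomputable def batch (c : ℝ) : Slip → List Rect → List Slip × Slip
  | s, [] => ([], s)
  | s, r :: rs =>
      if s.packedHeight + r.height ≤ c then batch c (s.push r) rs
      else (s :: (batch c ⟨r, []⟩ rs).1, (batch c ⟨r, []⟩ rs).2)

/-- Stack the rectangles of a list on top of each other, with left edges at `x`, starting at height
`y`. -/
noncomputable def stack (x : ℝ) : ℝ → List Rect → List PlacedRect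
  | _, [] => []
  | y, r :: rs => ⟨r, x, y⟩ :: stack x (y + r.height) rs

/-- The left edge of the `k`-th item in its bin, when the items of a bin are put side by side, from
left to right, in the order in which they are listed. -/
noncomputable def BinPacking.offset {l : List Size} (P : BinPacking l) (k : Fin l.length) : ℝ :=
  ∑ j ∈ Finset.univ.filter (fun j => j < k ∧ P.bin j = P.bin k), (l.get j : ℝ)

/-- The second stage: the slips `S`, seen as items of size their widths, are packed by `A`. The
`b`-th bin (`b = 0, 1, …`) is the part of the strip between the heights `b * c` and `(b + 1) * c`.
The slip `last` is put on top of all bins. -/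
noncomputable def packSlips (A : BinPackingAlgorithm) (c : ℝ) (S : List Slip) (last : Slip) :
    List PlacedRect :=
  let P := A (S.map Slip.width)
  (List.finRange S.length).flatMap (fun k =>
      let i : Fin (S.map Slip.width).length := k.cast (List.length_map _).symm
      stack (P.offset i) ((P.bin i : ℕ) * c) (S.get k).rects)
    ++ stack 0 (P.numBins * c) last.rects

/-- The rectangles, sorted by nonincreasing width. -/
noncomputable def sortByWidth (L : List Rect) : List Rect :=
  L.insertionSort (fun r s => s.width ≤ r.width)

/-- The strip packing algorithm `B&P_A` with slips of height `c`. -/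
noncomputable def batchAndPack (A : BinPackingAlgorithm) (c : ℝ) (L : List Rect) :
    List PlacedRect :=
  match sortByWidth L with
  | [] => []
  | r :: rs => packSlips A c (batch c ⟨r, []⟩ rs).1 (batch c ⟨r, []⟩ rs).2

/-!
Batch-and-pack asks `A` to pack the slip widths `W`, and its height is `c * A(W)` up to an additive
`c` (`batchAndPack_spec`). So everything rests on comparing `c * binOPT W` with `stripOPT L`.

In one direction, `stripOPT L ≤ c * binOPT W + c`, by running the algorithm with optimal bin
packings (`stripOPT_le_binOPT_slipWidths`). In the other direction,
`binOPT W ≤ (1 + 2 * ε) * stripOPT L / (c - 1) + K`, where `K` depends on `ε` only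
(`binOPT_slipWidths_le`). For this, consider a strip packing of height `H`. The rectangles met by a
horizontal line have total width at most `1`, so the line is a bin, and the family of all lines is a
fractional packing. It is rounded to a packing by linear grouping: the slips of width at least `ε`
are split into boundedly many groups of equal cardinality, and a line is classified by the number of
rectangles it meets in each group. The number of classes does not depend on `H`. A class of total
length `ℓ` yields `⌈ℓ / (c - 1)⌉` bins, and since each closed slip has height more than `c - 1`,
these have enough places for the slips of each group, in which the slips of the next group fit
because the widths are sorted. The first group is small and gets bins of its own, and the slips of
width less than `ε` are added greedily, at a cost controlled by the area of the rectangles.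

The first comparison shows that `binOPT W → ∞` as `stripOPT L → ∞`, so that the asymptotic guarantee
of `A` applies, and the second one then gives a ratio of at most `A.ratio * c / (c - 1)`.
Conversely, every bin packing instance `l` is, up to its order, the list of slip widths of some `L`
(`exists_slipWidths_perm`). If `A` ignores the order, the height of the packing of `L` is at least
`c * A(l)`, whereas `stripOPT L ≤ c * binOPT l + c`. Hence `A.ratio` is a lower bound for each
`c > 1` (`ratio_le_stripRatio_batchAndPack`).
-/

open MeasureTheory

/-! ### Bin packing of finite families -/

/-- The items `i ∈ s`, of sizes `w i`, can be packed into `n` bins of capacity `1`, some of which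
may stay empty. The bins are numbered `0, …, n - 1`. -/
def FitsInBins {ι : Type*} (w : ι → ℝ) (s : Finset ι) (n : ℕ) : Prop :=
  ∃ f : ι → ℕ, (∀ i ∈ s, f i < n) ∧ ∀ b, ∑ i ∈ s with f i = b, w i ≤ 1

namespace FitsInBins

variable {ι κ : Type*} {w : ι → ℝ} {s : Finset ι} {n : ℕ}

theorem mono_right {m : ℕ} (h : FitsInBins w s n) (hnm : n ≤ m) : FitsInBins w s m := by
  obtain ⟨f, hf, hc⟩ := h
  exact ⟨f, fun i hi => (hf i hi).trans_le hnm, hc⟩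

/-- Items that are assigned injectively to larger items fit into the bins of these. -/
theorem of_injOn {v : κ → ℝ} {t : Finset κ} (h : FitsInBins v t n) (g : ι → κ)
    (hg : Set.InjOn g s) (hst : ∀ i ∈ s, g i ∈ t) (hwv : ∀ i ∈ s, w i ≤ v (g i))
    (hv : ∀ j ∈ t, 0 ≤ v j) : FitsInBins w s n := by
  classical
  obtain ⟨f, hf, hc⟩ := h
  refine ⟨f ∘ g, fun i hi => hf _ (hst i hi), fun b => ?_⟩
  calc ∑ i ∈ s with (f ∘ g) i = b, w i ≤ ∑ i ∈ s with (f ∘ g) i = b, v (g i) :=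
        Finset.sum_le_sum fun i hi => hwv i (Finset.mem_filter.1 hi).1
    _ = ∑ j ∈ (s.filter fun i => (f ∘ g) i = b).image g, v j := by
        rw [Finset.sum_image]
        intro i hi j hj hij
        exact hg (Finset.mem_filter.1 hi).1 (Finset.mem_filter.1 hj).1 hij
    _ ≤ ∑ j ∈ t with f j = b, v j := by
        refine Finset.sum_le_sum_of_subset_of_nonneg ?_ fun j hj _ => hv j (Finset.mem_filter.1 hj).1
        intro j hj
        obtain ⟨i, hi, rfl⟩ := Finset.mem_image.1 hj
        have := Finset.mem_filter.1 hi
        exact Finset.mem_filter.2 ⟨hst i this.1, this.2⟩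
    _ ≤ 1 := hc b

theorem union [DecidableEq ι] {t : Finset ι} {m : ℕ} (hs : FitsInBins w s n)
    (ht : FitsInBins w t m) (hst : Disjoint s t) : FitsInBins w (s ∪ t) (n + m) := by
  obtain ⟨f, hf, hfc⟩ := hs
  obtain ⟨g, hg, hgc⟩ := ht
  have hns : ∀ i ∈ t, i ∉ s := fun i hi his => Finset.disjoint_left.1 hst his hi
  refine ⟨fun i => if i ∈ s then f i else n + g i, fun i hi => ?_, fun b => ?_⟩
  · rcases Finset.mem_union.1 hi with h | h
    · have := hf i h
      simp only [h, if_true]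
      omega
    · have := hg i h
      simp only [hns i h, if_false]
      omega
  · rw [Finset.filter_union, Finset.sum_union
      (Finset.disjoint_filter_filter hst)]
    have h1 : s.filter (fun i => (if i ∈ s then f i else n + g i) = b)
        = s.filter (fun i => f i = b) :=
      Finset.filter_congr fun i hi => by simp [hi]
    have h2 : t.filter (fun i => (if i ∈ s then f i else n + g i) = b)
        = t.filter (fun i => n + g i = b) :=
      Finset.filter_congr fun i hi => by simp [hns i hi]
    rw [h1, h2]
    by_cases hb : b < n
    · have : t.filter (fun i => n + g i = b) = ∅ :=
        Finset.filter_false_of_mem fun i _ => by omega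
      rw [this]
      simpa using hfc b
    · have h3 : s.filter (fun i => f i = b) = ∅ :=
        Finset.filter_false_of_mem fun i hi => by have := hf i hi; omega
      have h4 : t.filter (fun i => n + g i = b) = t.filter (fun i => g i = b - n) :=
        Finset.filter_congr fun i _ => by omega
      rw [h3, h4]
      simpa using hgc (b - n)

theorem range_self {w : ℕ → ℝ} {q : ℕ} (hw : ∀ k < q, w k ≤ 1) :
    FitsInBins w (Finset.range q) q := by
  refine ⟨id, fun i hi => Finset.mem_range.1 hi, fun b => ?_⟩
  by_cases hb : b < q
  · simpa [Finset.filter_eq', hb] using hw b hb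
  · simp [Finset.filter_eq', hb]

/-- The bins may be labelled by any finite type. -/
theorem of_fintype {β : Type*} [Fintype β] [DecidableEq β] (f : ι → β)
    (hc : ∀ b, ∑ i ∈ s with f i = b, w i ≤ 1) : FitsInBins w s (Fintype.card β) := by
  classical
  refine ⟨fun i => Fintype.equivFin β (f i), fun i _ => Fin.is_lt _, fun b => ?_⟩
  by_cases hb : b < Fintype.card β
  · refine le_of_eq_of_le ?_ (hc ((Fintype.equivFin β).symm ⟨b, hb⟩))
    refine Finset.sum_congr (Finset.filter_congr fun i _ => ?_) fun _ _ => rfl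
    rw [Equiv.eq_symm_apply, Fin.ext_iff]
  · rw [Finset.filter_false_of_mem fun i _ => by
      exact fun h => hb (h ▸ ((Fintype.equivFin β) (f i)).is_lt)]
    simp

/-- Items of size at most `ε` can be added greedily: as long as every bin is filled to more than
`1 - ε`, the total size exceeds `n * (1 - ε)`. -/
theorem union_small [DecidableEq ι] {ε : ℝ} (hs : FitsInBins w s n) (t : Finset ι)
    (hst : Disjoint s t) (ht0 : ∀ i ∈ t, 0 < w i) (ht : ∀ i ∈ t, w i ≤ ε)
    (hsum : ∑ i ∈ s ∪ t, w i ≤ n * (1 - ε)) : FitsInBins w (s ∪ t) n := by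
  induction t using Finset.induction_on with
  | empty => simpa using hs
  | insert a t hat ih =>
    have ha0 := ht0 a (Finset.mem_insert_self a t)
    have haε := ht a (Finset.mem_insert_self a t)
    have has : a ∉ s := fun h =>
      Finset.disjoint_left.1 hst h (Finset.mem_insert_self a t)
    have hau : a ∉ s ∪ t := by simp [has, hat]
    rw [Finset.union_insert, Finset.sum_insert hau] at hsum
    obtain ⟨f, hf, hc⟩ := ih (hst.mono_right (Finset.subset_insert a t))
      (fun i hi => ht0 i (Finset.mem_insert_of_mem hi))
      (fun i hi => ht i (Finset.mem_insert_of_mem hi)) (by linarith)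
    have hfib : ∑ b ∈ Finset.range n, ∑ i ∈ s ∪ t with f i = b, w i = ∑ i ∈ s ∪ t, w i :=
      Finset.sum_fiberwise_of_maps_to (fun i hi => Finset.mem_range.2 (hf i hi)) _
    obtain ⟨b, hbn, hb⟩ : ∃ b < n, ∑ i ∈ s ∪ t with f i = b, w i ≤ 1 - ε := by
      by_contra! hcon
      have : ∑ _b ∈ Finset.range n, (1 - ε) ≤
          ∑ b ∈ Finset.range n, ∑ i ∈ s ∪ t with f i = b, w i :=
        Finset.sum_le_sum fun b hb => (hcon b (Finset.mem_range.1 hb)).le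
      rw [hfib, Finset.sum_const, Finset.card_range, nsmul_eq_mul] at this
      linarith
    rw [Finset.union_insert]
    refine ⟨Function.update f a b, fun i hi => ?_, fun b' => ?_⟩
    · rcases Finset.mem_insert.1 hi with rfl | h
      · simpa using hbn
      · rw [Function.update_of_ne (by rintro rfl; exact hau h)]
        exact hf i h
    · have hcongr : (s ∪ t).filter (fun i => Function.update f a b i = b')
          = (s ∪ t).filter (fun i => f i = b') :=
        Finset.filter_congr fun i hi => by
          rw [Function.update_of_ne (by rintro rfl; exact hau hi)]
      rw [Finset.filter_insert, hcongr, Function.update_self]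
      split_ifs with h
      · subst h
        rw [Finset.sum_insert (fun h => hau (Finset.mem_filter.1 h).1)]
        linarith
      · exact hc b'

end FitsInBins

theorem binOPT_le_numBins {l : List Size} (P : BinPacking l) : binOPT l ≤ P.numBins :=
  Nat.sInf_le ⟨P, rfl⟩

/-- Discarding the empty bins turns any assignment to bins into a packing. -/
theorem exists_binPacking_of_fitsInBins {l : List Size} {n : ℕ}
    (h : FitsInBins (fun k => (l.get k : ℝ)) Finset.univ n) :
    ∃ P : BinPacking l, P.numBins ≤ n := by
  classical
  obtain ⟨f, hf, hc⟩ := h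
  let T := Finset.univ.image f
  have hT : ∀ k, f k ∈ T := fun k => Finset.mem_image_of_mem f (Finset.mem_univ k)
  refine ⟨⟨T.card, fun k => T.equivFin ⟨f k, hT k⟩, fun b => ?_, fun b => ?_⟩, ?_⟩
  · obtain ⟨k, -, hk⟩ := Finset.mem_image.1 (T.equivFin.symm b).2
    refine ⟨k, ?_⟩
    rw [← Equiv.eq_symm_apply]
    exact Subtype.ext hk
  · refine le_of_eq_of_le ?_ (hc (T.equivFin.symm b))
    refine Finset.sum_congr (Finset.filter_congr fun i _ => ?_) fun _ _ => rfl
    rw [← Equiv.eq_symm_apply, Subtype.ext_iff]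
  · refine (Finset.card_le_card (s := T) (t := Finset.range n) fun x hx => ?_).trans_eq
      (Finset.card_range n)
    obtain ⟨k, -, rfl⟩ := Finset.mem_image.1 hx
    exact Finset.mem_range.2 (hf k (Finset.mem_univ k))

theorem binOPT_le_of_fitsInBins {l : List Size} {n : ℕ}
    (h : FitsInBins (fun k => (l.get k : ℝ)) Finset.univ n) : binOPT l ≤ n := by
  obtain ⟨P, hP⟩ := exists_binPacking_of_fitsInBins h
  exact (binOPT_le_numBins P).trans hP

theorem fitsInBins_binPacking {l : List Size} (P : BinPacking l) :
    FitsInBins (fun k => (l.get k : ℝ)) Finset.univ P.numBins := by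
  simpa using FitsInBins.of_fintype (w := fun k => (l.get k : ℝ)) (s := Finset.univ) P.bin P.capacity

/-- A packing with the minimum number of bins. -/
theorem exists_optimal_binPacking (l : List Size) : ∃ P : BinPacking l, P.numBins = binOPT l := by
  have hne : {m : ℕ | ∃ P : BinPacking l, P.numBins = m}.Nonempty := by
    obtain ⟨P, -⟩ := exists_binPacking_of_fitsInBins (l := l) (n := l.length)
      (by
        simpa using FitsInBins.of_fintype (w := fun k => (l.get k : ℝ)) (s := Finset.univ) id
          fun b => by simpa [Finset.filter_eq'] using (l.get b).2.2)
    exact ⟨_, P, rfl⟩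
  exact Nat.sInf_mem hne

/-- A rearrangement of the images lifts to a rearrangement of the list. -/
theorem List.Perm.exists_perm_map_eq {α β : Type*} {f : α → β} {l : List α} {m : List β}
    (h : (l.map f).Perm m) : ∃ l' : List α, l'.Perm l ∧ l'.map f = m := by
  have h1 : Relation.Comp (fun x y => x = List.map f y) List.Perm m l := by
    rw [List.eq_map_comp_perm]
    exact h.symm
  obtain ⟨l', hm, hl⟩ := h1
  exact ⟨l', hl, hm.symm⟩

theorem binOPT_le_of_perm {l₁ l₂ : List Size} (h : l₁.Perm l₂) : binOPT l₂ ≤ binOPT l₁ := by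
  obtain ⟨P, hP⟩ := exists_optimal_binPacking l₁
  have hfr : ((List.finRange l₁.length).map l₁.get).Perm l₂ := by
    simpa using h
  obtain ⟨F, hF, hFl⟩ := hfr.exists_perm_map_eq
  have hlen : l₂.length = F.length := by rw [← hFl, List.length_map]
  have hnd : F.Nodup := hF.nodup_iff.2 (List.nodup_finRange _)
  rw [← hP]
  refine binOPT_le_of_fitsInBins ((fitsInBins_binPacking P).of_injOn
    (fun k => F.get (k.cast hlen)) ?_ (fun _ _ => Finset.mem_univ _) (fun k _ => ?_)
    (fun j _ => (l₁.get j).2.1.le))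
  · intro i _ j _ hij
    have := hnd.injective_get hij
    simpa using this
  · subst hFl
    simp

theorem binOPT_eq_of_perm {l₁ l₂ : List Size} (h : l₁.Perm l₂) : binOPT l₁ = binOPT l₂ :=
  (binOPT_le_of_perm h.symm).antisymm (binOPT_le_of_perm h)

/-! ### From horizontal lines to bins -/

/-- A weighted sum of lengths of intervals, computed by integrating the total weight of those
intervals that are active at a height `t`. -/
theorem sum_mul_length_eq_integral {ι : Type*} (s : Finset ι) (y h a : ι → ℝ) {H : ℝ}
    (hy : ∀ i ∈ s, 0 ≤ y i) (hh : ∀ i ∈ s, 0 ≤ h i) (hH : ∀ i ∈ s, y i + h i ≤ H) :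
    ∑ i ∈ s, h i * a i = ∫ t in Set.Ico 0 H,
      ∑ i ∈ s with t ∈ Set.Ico (y i) (y i + h i), a i := by
  classical
  have h1 : ∀ t : ℝ, ∑ i ∈ s with t ∈ Set.Ico (y i) (y i + h i), a i
      = ∑ i ∈ s, (Set.Ico (y i) (y i + h i)).indicator (fun _ => a i) t := by
    intro t
    rw [Finset.sum_filter]
    exact Finset.sum_congr rfl fun i _ => by simp [Set.indicator_apply]
  simp_rw [h1]
  rw [integral_finsetSum]
  · refine Finset.sum_congr rfl fun i hi => ?_
    rw [setIntegral_indicator measurableSet_Ico, setIntegral_const,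
      Set.inter_eq_right.2 (Set.Ico_subset_Ico (hy i hi) (hH i hi))]
    simp [hh i hi]
  · intro i _
    exact (integrable_const (a i)).indicator measurableSet_Ico

/-- The integral of a function that depends only on a type with finitely many values. -/
theorem integral_comp_fintype {T : Type*} [Fintype T] [MeasurableSpace T]
    [MeasurableSingletonClass T] (μ : Measure ℝ) [IsFiniteMeasure μ] {φ : ℝ → T}
    (hφ : Measurable φ) (F : T → ℝ) :
    ∫ t, F (φ t) ∂μ = ∑ τ, (μ.map φ).real {τ} * F τ := by
  rw [← integral_map hφ.aemeasurable (by fun_prop : AEStronglyMeasurable F _),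
    integral_fintype Integrable.of_finite]
  simp

/-- Rounding of a fractional packing. The rectangles `i` occupy the heights
`[y i, y i + h i) ⊆ [0, H)`, and at every height the widths of those present add up to at most `1`.
If `S 0, …, S (G - 1)` are groups of rectangles, those of `S g` of width at least `v g ≥ ε` and of
total height at least `q * d`, then `q` items of each of the sizes `v 0, …, v (G - 1)` fit into
`H / d + (M + 1) ^ G` bins, where `M = ⌊1 / ε⌋`.

The type of a height counts the rectangles of each group that are present there; there are at most
`(M + 1) ^ G` types. A type that occurs on total length `ℓ` gives rise to `⌈ℓ / d⌉` bins. -/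
theorem exists_fitsInBins_of_active {ι : Type*} [Fintype ι] {y h w : ι → ℝ} {H d ε : ℝ}
    (hd : 0 < d) (hε : 0 < ε) (hH0 : 0 ≤ H)
    (hy : ∀ i, 0 ≤ y i) (hh : ∀ i, 0 ≤ h i) (hH : ∀ i, y i + h i ≤ H) (hw : ∀ i, 0 ≤ w i)
    (hact : ∀ t, ∑ i with t ∈ Set.Ico (y i) (y i + h i), w i ≤ 1)
    {G q : ℕ} (S : Fin G → Finset ι) (hS : Pairwise fun g g' => Disjoint (S g) (S g'))
    (v : Fin G → ℝ) (hvε : ∀ g, ε ≤ v g) (hv : ∀ g, ∀ i ∈ S g, v g ≤ w i)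
    (hSh : ∀ g, q * d ≤ ∑ i ∈ S g, h i) :
    ∃ N : ℕ, (N : ℝ) ≤ H / d + ((⌊1 / ε⌋₊ + 1) ^ G : ℕ) ∧
      FitsInBins (fun p : Fin G × Fin q => v p.1) Finset.univ N := by
  classical
  set M := ⌊1 / ε⌋₊ with hM
  let act : ℝ → Fin G → Finset ι := fun t g =>
    (S g).filter fun i => t ∈ Set.Ico (y i) (y i + h i)
  have hload : ∀ t, ∑ g, ((act t g).card : ℝ) * v g ≤ 1 := by
    intro t
    refine le_trans ?_ (hact t)
    calc ∑ g, ((act t g).card : ℝ) * v g ≤ ∑ g, ∑ i ∈ act t g, w i := by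
          refine Finset.sum_le_sum fun g _ => ?_
          rw [← nsmul_eq_mul]
          exact Finset.card_nsmul_le_sum _ _ _ fun i hi => hv g i (Finset.mem_filter.1 hi).1
      _ = ∑ i ∈ Finset.univ.biUnion (act t), w i := by
          rw [Finset.sum_biUnion]
          intro g _ g' _ hne
          exact Finset.disjoint_filter_filter (hS hne)
      _ ≤ ∑ i with t ∈ Set.Ico (y i) (y i + h i), w i := by
          refine Finset.sum_le_sum_of_subset_of_nonneg ?_ fun i _ _ => hw i
          intro i hi
          obtain ⟨g, -, hg⟩ := Finset.mem_biUnion.1 hi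
          exact Finset.mem_filter.2 ⟨Finset.mem_univ i, (Finset.mem_filter.1 hg).2⟩
  have hcard : ∀ t g, (act t g).card < M + 1 := by
    intro t g
    rw [Nat.lt_succ_iff, hM, Nat.le_floor_iff (by positivity), le_div_iff₀ hε]
    calc ((act t g).card : ℝ) * ε ≤ (act t g).card * v g := by gcongr; exact hvε g
      _ ≤ ∑ g, ((act t g).card : ℝ) * v g :=
          Finset.single_le_sum (f := fun g => ((act t g).card : ℝ) * v g)
            (fun g _ => mul_nonneg (Nat.cast_nonneg _) (hε.le.trans (hvε g))) (Finset.mem_univ g)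
      _ ≤ 1 := hload t
  let φ : ℝ → Fin G → Fin (M + 1) := fun t g => ⟨(act t g).card, hcard t g⟩
  have hφ : Measurable φ := by
    refine measurable_pi_iff.2 fun g => ?_
    have hm : Measurable fun t => (act t g).card := by
      simp only [act, Finset.card_filter]
      exact Finset.measurable_sum _ fun i _ =>
        Measurable.ite measurableSet_Ico measurable_const measurable_const
    refine measurable_to_countable' fun a => ?_
    have : (fun t => φ t g) ⁻¹' {a} = (fun t => (act t g).card) ⁻¹' {(a : ℕ)} := by
      ext t
      simp [φ, Fin.ext_iff]
    rw [this]
    exact hm (measurableSet_singleton _)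
  set μ : Measure ℝ := volume.restrict (Set.Ico 0 H)
  let ℓ : (Fin G → Fin (M + 1)) → ℝ := fun τ => (μ.map φ).real {τ}
  have hℓ0 : ∀ τ, 0 ≤ ℓ τ := fun τ => measureReal_nonneg
  have hℓsum : ∑ τ, ℓ τ = H := by
    have := integral_comp_fintype μ hφ fun _ => 1
    simpa [μ, ℓ, hH0] using this.symm
  have hℓocc : ∀ τ, 0 < ℓ τ → ∃ t, φ t = τ := by
    intro τ hτ
    by_contra! hcon
    have : φ ⁻¹' {τ} = ∅ := by
      ext t
      simpa using hcon t
    simp [ℓ, Measure.real, Measure.map_apply hφ (measurableSet_singleton τ), this] at hτ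
  let n : (Fin G → Fin (M + 1)) → ℕ := fun τ => ⌈ℓ τ / d⌉₊
  have hslots : ∀ g, q ≤ ∑ τ, n τ * (τ g : ℕ) := by
    intro g
    have h1 : (q : ℝ) * d ≤ ∑ τ, ℓ τ * ((τ g : ℕ) : ℝ) := by
      refine (hSh g).trans_eq ?_
      have h3 := sum_mul_length_eq_integral (S g) y h (fun _ => 1) (fun i _ => hy i)
        (fun i _ => hh i) (fun i _ => hH i)
      simp only [mul_one, Finset.sum_const, nsmul_eq_mul] at h3
      rw [h3]
      exact integral_comp_fintype μ hφ fun τ => ((τ g : ℕ) : ℝ)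
    have h2 : (q : ℝ) * d ≤ (∑ τ, (n τ : ℝ) * ((τ g : ℕ) : ℝ)) * d := by
      refine h1.trans ?_
      rw [Finset.sum_mul]
      refine Finset.sum_le_sum fun τ _ => ?_
      have : ℓ τ ≤ n τ * d := (div_le_iff₀ hd).1 (Nat.le_ceil _)
      calc ℓ τ * ((τ g : ℕ) : ℝ) ≤ n τ * d * ((τ g : ℕ) : ℝ) := by gcongr
        _ = _ := by ring
    exact_mod_cast le_of_mul_le_mul_right h2 hd
  -- choice of `q` distinct slots of size `v g` in the bins
  have hemb : ∀ g, Nonempty (Fin q ↪ (Σ τ, Fin (n τ) × Fin (τ g))) := by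
    intro g
    refine Function.Embedding.nonempty_of_card_le ?_
    simpa [Fintype.card_sigma] using hslots g
  let e := fun g => (hemb g).some
  let bin : Fin G × Fin q → Σ τ, Fin (n τ) := fun p => ⟨(e p.1 p.2).1, (e p.1 p.2).2.1⟩
  refine ⟨Fintype.card (Σ τ, Fin (n τ)), ?_, FitsInBins.of_fintype bin ?_⟩
  · have hcardT : Fintype.card (Fin G → Fin (M + 1)) = (M + 1) ^ G := by simp
    calc ((Fintype.card (Σ τ, Fin (n τ)) : ℕ) : ℝ) = ∑ τ, (n τ : ℝ) := by
          simp [Fintype.card_sigma]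
      _ ≤ ∑ τ, (ℓ τ / d + 1) :=
          Finset.sum_le_sum fun τ _ => (Nat.ceil_lt_add_one (div_nonneg (hℓ0 τ) hd.le)).le
      _ = H / d + ((M + 1) ^ G : ℕ) := by
          rw [Finset.sum_add_distrib, ← Finset.sum_div, hℓsum, ← hcardT]
          simp
  · rintro ⟨τ, j⟩
    have hτ : 0 < ℓ τ := by
      by_contra hcon
      have : n τ = 0 := Nat.ceil_eq_zero.2 (div_nonpos_of_nonpos_of_nonneg (not_lt.1 hcon) hd.le)
      exact absurd j.is_lt (by omega)
    obtain ⟨t, rfl⟩ := hℓocc τ hτ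
    refine le_trans ?_ (hload t)
    rw [Finset.sum_filter, ← Finset.univ_product_univ, Finset.sum_product]
    refine Finset.sum_le_sum fun g _ => ?_
    rw [← Finset.sum_filter]
    simp only [Finset.sum_const, nsmul_eq_mul]
    refine mul_le_mul_of_nonneg_right ?_ (hε.le.trans (hvε g))
    -- distinct items of size `v g` in this bin occupy distinct slots
    have hinj : ((Finset.univ.filter fun p => bin (g, p) = ⟨φ t, j⟩).image (e g)) ⊆
        (Finset.univ : Finset (Fin (φ t g))).image
          fun s => (⟨φ t, j, s⟩ : Σ τ, Fin (n τ) × Fin (τ g)) := by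
      intro x hx
      obtain ⟨p, hp, rfl⟩ := Finset.mem_image.1 hx
      have hp := (Finset.mem_filter.1 hp).2
      simp only [bin] at hp
      generalize e g p = z at hp
      obtain ⟨τ', j', s'⟩ := z
      simp only [Sigma.mk.injEq] at hp
      obtain ⟨rfl, hj⟩ := hp
      obtain rfl := eq_of_heq hj
      exact Finset.mem_image_of_mem _ (Finset.mem_univ s')
    have := (Finset.card_le_card hinj).trans Finset.card_image_le
    rw [Finset.card_image_of_injective _ (e g).injective] at this
    simpa [φ] using this

/-- The additive constant in the comparison of `binOPT` with `stripOPT`. The power bounds the number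
of types when there are at most `1 / ε ^ 2` groups; the `3` absorbs the rounding. -/
noncomputable def roundingConstant (ε : ℝ) : ℝ :=
  ((⌊1 / ε⌋₊ + 1) ^ ⌊1 / ε ^ 2⌋₊ : ℕ) + 3

/-- Linear grouping. The rectangles `i` occupy the heights `[y i, y i + h i) ⊆ [0, H)`, and at every
height the widths of those present add up to at most `1`. The rectangles with `slip i = k` have
total height at least `d`, and their widths are at least the size `W k'` of each later item `k'`.
Then the items `0, …, m - 1` fit into about `H / d` bins.

The items of size at least `ε`, at most `(1 + H / d) / ε` many, are split into groups of `q`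
consecutive ones. The first group gets its own bins; each other group is packed in the place of the
rectangles of the preceding group. The smaller items are added greedily. -/
theorem exists_fitsInBins_of_slips {ι : Type*} [Fintype ι] {y h w : ι → ℝ} {H d ε : ℝ}
    (hd : 0 < d) (hε : 0 < ε) (hε2 : ε ≤ 1 / 2) (hH0 : 0 ≤ H)
    (hy : ∀ i, 0 ≤ y i) (hh : ∀ i, 0 ≤ h i) (hH : ∀ i, y i + h i ≤ H) (hw : ∀ i, 0 ≤ w i)
    (hact : ∀ t, ∑ i with t ∈ Set.Ico (y i) (y i + h i), w i ≤ 1)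
    {m : ℕ} (slip : ι → ℕ) (W : ℕ → ℝ) (hW0 : ∀ k < m, 0 < W k) (hW1 : ∀ k < m, W k ≤ 1)
    (hWanti : ∀ j k, j ≤ k → k < m → W k ≤ W j)
    (hslip : ∀ i k, slip i < k → k < m → W k ≤ w i)
    (hfull : ∀ k < m, d ≤ ∑ i with slip i = k, h i) :
    ∃ N : ℕ, (N : ℝ) ≤ (1 + 2 * ε) * (H / d) + roundingConstant ε ∧
      FitsInBins W (Finset.range m) N := by
  classical
  have hHd : 0 ≤ H / d := div_nonneg hH0 hd.le
  -- The items `1, 2, …` are at most as wide as the rectangles of the preceding slip, so they are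
  -- bounded by the area; item `0` accounts for the summand `1`.
  have hsumW : ∑ k ∈ Finset.range m, W k ≤ 1 + H / d := by
    have harea : ∑ i, h i * w i ≤ H := by
      rw [sum_mul_length_eq_integral Finset.univ y h w (fun i _ => hy i) (fun i _ => hh i)
        (fun i _ => hH i)]
      calc ∫ t in Set.Ico 0 H, ∑ i with t ∈ Set.Ico (y i) (y i + h i), w i
          ≤ ∫ t in Set.Ico 0 H, (1 : ℝ) :=
            integral_mono_of_nonneg (ae_of_all _ fun t => Finset.sum_nonneg fun i _ => hw i)
              (integrable_const 1) (ae_of_all _ hact)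
        _ = H := by simp [hH0]
    cases m with
    | zero => simpa using by linarith
    | succ m =>
      rw [Finset.sum_range_succ']
      have h1 : (∑ k ∈ Finset.range m, W (k + 1)) * d ≤ H := by
        calc (∑ k ∈ Finset.range m, W (k + 1)) * d
            = ∑ k ∈ Finset.range m, d * W (k + 1) := by
              rw [Finset.sum_mul]
              exact Finset.sum_congr rfl fun k _ => mul_comm _ _
          _ ≤ ∑ k ∈ Finset.range m, ∑ i with slip i = k, h i * w i := by
              refine Finset.sum_le_sum fun k hk => ?_
              have hk := Finset.mem_range.1 hk
              calc d * W (k + 1) ≤ (∑ i with slip i = k, h i) * W (k + 1) :=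
                    mul_le_mul_of_nonneg_right (hfull k (by omega)) (hW0 _ (by omega)).le
                _ = ∑ i with slip i = k, h i * W (k + 1) := Finset.sum_mul _ _ _
                _ ≤ _ := Finset.sum_le_sum fun i hi => mul_le_mul_of_nonneg_left
                    (hslip i (k + 1) (by have := (Finset.mem_filter.1 hi).2; omega) (by omega))
                    (hh i)
          _ = ∑ i with slip i ∈ Finset.range m, h i * w i := by
              rw [Finset.sum_fiberwise_eq_sum_filter]
          _ ≤ ∑ i, h i * w i :=
              Finset.sum_le_sum_of_subset_of_nonneg (Finset.filter_subset _ _)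
                fun i _ _ => mul_nonneg (hh i) (hw i)
          _ ≤ H := harea
      have := (le_div_iff₀ hd).2 h1
      have := hW1 0 (by omega)
      linarith
  -- the items `0, …, b - 1` are those of size at least `ε`
  obtain ⟨b, hbm, hbig, hsmall⟩ : ∃ b ≤ m, (∀ k < b, ε ≤ W k) ∧
      ∀ k, b ≤ k → k < m → W k ≤ ε := by
    have hex : ∃ k, m ≤ k ∨ W k < ε := ⟨m, Or.inl le_rfl⟩
    refine ⟨Nat.find hex, Nat.find_min' hex (Or.inl le_rfl), fun k hk => ?_, fun k hk hkm => ?_⟩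
    · have := Nat.find_min hex hk
      push Not at this
      exact this.2
    · rcases Nat.find_spec hex with h1 | h1
      · omega
      · exact (hWanti _ k hk hkm).trans h1.le
  have hbε : (b : ℝ) * ε ≤ 1 + H / d := by
    refine le_trans ?_ hsumW
    calc (b : ℝ) * ε = ∑ _k ∈ Finset.range b, ε := by simp
      _ ≤ ∑ k ∈ Finset.range b, W k :=
          Finset.sum_le_sum fun k hk => hbig k (Finset.mem_range.1 hk)
      _ ≤ ∑ k ∈ Finset.range m, W k :=
          Finset.sum_le_sum_of_subset_of_nonneg (Finset.range_subset_range.2 hbm)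
            fun k hk _ => (hW0 k (Finset.mem_range.1 hk)).le
  -- The first group costs only `q ≈ ε ^ 2 * b ≤ ε * (1 + H / d)` bins, and the number of groups is
  -- at most `1 / ε ^ 2`.
  set q := ⌊ε ^ 2 * b⌋₊ + 1 with hq
  have hq0 : 0 < q := by omega
  have hqlt : ε ^ 2 * b < q := by
    rw [hq]
    push_cast
    exact Nat.lt_floor_add_one _
  have hqle : (q : ℝ) ≤ ε ^ 2 * b + 1 := by
    rw [hq]
    push_cast
    have := Nat.floor_le (show 0 ≤ ε ^ 2 * b by positivity)
    linarith
  set G := (b - 1) / q with hG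
  have hGq : ∀ g < G, (g + 1) * q < b := by
    intro g hg
    have h1 : (g + 1) * q ≤ G * q := Nat.mul_le_mul_right q hg
    have h2 : G * q ≤ b - 1 := Nat.div_mul_le_self _ _
    have h3 : 0 < (g + 1) * q := by positivity
    omega
  have hGle : G ≤ ⌊1 / ε ^ 2⌋₊ := by
    rcases Nat.eq_zero_or_pos G with h0 | hpos
    · omega
    have hGqb : G * q ≤ b := by
      have : G * q ≤ b - 1 := Nat.div_mul_le_self _ _
      omega
    have hb0 : 0 < b := by
      have : 0 < G * q := by positivity
      omega
    rw [Nat.le_floor_iff (by positivity), le_div_iff₀ (by positivity)]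
    have h1 : (G : ℝ) * (ε ^ 2 * b) ≤ b :=
      calc (G : ℝ) * (ε ^ 2 * b) ≤ G * q := by gcongr
        _ ≤ b := by exact_mod_cast hGqb
    have hb0' : (0 : ℝ) < b := by exact_mod_cast hb0
    refine le_of_mul_le_mul_right ?_ hb0'
    linarith
  have hdivlt : ∀ g k : ℕ, k / q = g ↔ g * q ≤ k ∧ k < (g + 1) * q := fun g k => by
    rw [Nat.div_eq_iff hq0]
    have : (g + 1) * q = g * q + q := by ring
    omega
  obtain ⟨N₁, hN₁, hfit⟩ := exists_fitsInBins_of_active (q := q) hd hε hH0 hy hh hH hw hact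
    (fun g : Fin G => Finset.univ.filter fun i => slip i / q = (g : ℕ))
    (by
      intro g g' hne
      refine Finset.disjoint_left.2 fun i hi hi' => hne (Fin.ext ?_)
      exact (Finset.mem_filter.1 hi).2.symm.trans (Finset.mem_filter.1 hi').2)
    (fun g => W ((g + 1) * q)) (fun g => hbig _ (hGq g g.2))
    (fun g i hi => hslip i _ ((hdivlt _ _).1 (Finset.mem_filter.1 hi).2).2
      ((hGq g g.2).trans_le hbm))
    (by
      intro g
      have hset : (Finset.univ.filter fun i => slip i / q = (g : ℕ)) =
          Finset.univ.filter fun i => slip i ∈ Finset.Ico ((g : ℕ) * q) ((g + 1) * q) :=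
        Finset.filter_congr fun i _ => by rw [hdivlt, Finset.mem_Ico]
      rw [hset, ← Finset.sum_fiberwise_eq_sum_filter]
      have hcard : (Finset.Ico ((g : ℕ) * q) ((g + 1) * q)).card = q := by
        rw [Nat.card_Ico, Nat.add_mul]
        omega
      have := Finset.card_nsmul_le_sum (Finset.Ico ((g : ℕ) * q) ((g + 1) * q))
        (fun k => ∑ i with slip i = k, h i) d fun k hk =>
          hfull k (by have := (Finset.mem_Ico.1 hk).2; have := hGq g g.2; omega)
      rwa [hcard, nsmul_eq_mul] at this)
  -- the group of item `k` is `k / q`; it uses the bins obtained from group `k / q - 1`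
  have hfitMiddle : FitsInBins W (Finset.Ico q b) N₁ := by
    rcases Nat.eq_zero_or_pos G with h0 | hpos
    · have hbq : b ≤ q := by
        rcases Nat.div_eq_zero_iff.1 (hG ▸ h0) with h | h <;> omega
      rw [Finset.Ico_eq_empty_of_le hbq]
      exact ⟨fun _ => 0, by simp, by simp⟩
    have hlt : ∀ k ∈ Finset.Ico q b, 1 ≤ k / q ∧ k / q - 1 < G := by
      intro k hk
      obtain ⟨h1, h2⟩ := Finset.mem_Ico.1 hk
      have h3 : 1 ≤ k / q := (Nat.one_le_div_iff hq0).2 h1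
      have h4 : k / q ≤ G := Nat.div_le_div_right (by omega)
      omega
    have : NeZero G := ⟨hpos.ne'⟩
    have : NeZero q := ⟨hq0.ne'⟩
    refine hfit.of_injOn (fun k => (Fin.ofNat G (k / q - 1), Fin.ofNat q k)) ?_
      (fun _ _ => Finset.mem_univ _) ?_
      (fun p _ => (hW0 _ ((hGq p.1 p.1.2).trans_le hbm)).le)
    · intro k hk k' hk' hkk
      have h1 := hlt k hk
      have h2 := hlt k' hk'
      simp only [Prod.mk.injEq, Fin.ext_iff, Fin.val_ofNat] at hkk
      rw [Nat.mod_eq_of_lt h1.2, Nat.mod_eq_of_lt h2.2] at hkk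
      have h3 : k / q = k' / q := by omega
      rw [← Nat.div_add_mod k q, ← Nat.div_add_mod k' q, h3, hkk.2]
    · intro k hk
      have h1 := hlt k hk
      have h2 := Finset.mem_Ico.1 hk
      simp only [Fin.val_ofNat]
      rw [Nat.mod_eq_of_lt h1.2, Nat.sub_add_cancel h1.1]
      exact hWanti _ _ (Nat.div_mul_le_self k q) (by omega)
  have hfitBig : FitsInBins W (Finset.range b) (q + N₁) := by
    have h1 : FitsInBins W (Finset.range (min q b)) q :=
      (FitsInBins.range_self fun k hk => hW1 k (by omega)).mono_right (min_le_left _ _)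
    have h2 := h1.union hfitMiddle (by
      rw [Finset.disjoint_left]
      intro k hk hk'
      have := Finset.mem_range.1 hk
      have := Finset.mem_Ico.1 hk'
      omega)
    have h3 : Finset.range b = Finset.range (min q b) ∪ Finset.Ico q b := by
      ext k
      simp only [Finset.mem_range, Finset.mem_union, Finset.mem_Ico]
      omega
    rwa [h3]
  set N₂ := ⌈(1 + H / d) / (1 - ε)⌉₊
  have hε1 : 0 < 1 - ε := by linarith
  have hall : FitsInBins W (Finset.range m) (max (q + N₁) N₂) := by
    have h3 : Finset.range m = Finset.range b ∪ Finset.Ico b m := by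
      ext k
      simp only [Finset.mem_range, Finset.mem_union, Finset.mem_Ico]
      omega
    have hdisj : Disjoint (Finset.range b) (Finset.Ico b m) := by
      rw [Finset.disjoint_left]
      intro k hk hk'
      have := Finset.mem_range.1 hk
      have := Finset.mem_Ico.1 hk'
      omega
    rw [h3]
    refine (hfitBig.mono_right (le_max_left _ N₂)).union_small (ε := ε) _ hdisj
      (fun k hk => hW0 k (Finset.mem_Ico.1 hk).2)
      (fun k hk => hsmall k (Finset.mem_Ico.1 hk).1 (Finset.mem_Ico.1 hk).2) ?_
    rw [← h3]
    refine hsumW.trans ((div_le_iff₀ hε1).1 ((Nat.le_ceil _).trans ?_))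
    exact_mod_cast le_max_right _ _
  refine ⟨_, ?_, hall⟩
  have hP : (((⌊1 / ε⌋₊ + 1) ^ G : ℕ) : ℝ) ≤ ((⌊1 / ε⌋₊ + 1) ^ ⌊1 / ε ^ 2⌋₊ : ℕ) := by
    exact_mod_cast Nat.pow_le_pow_right (by omega) hGle
  have hP0 : (0 : ℝ) ≤ ((⌊1 / ε⌋₊ + 1) ^ ⌊1 / ε ^ 2⌋₊ : ℕ) := Nat.cast_nonneg _
  rw [roundingConstant, Nat.cast_max]
  refine max_le ?_ ?_
  · have : ε * (b * ε) ≤ ε * (1 + H / d) := mul_le_mul_of_nonneg_left hbε hε.le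
    push_cast at hN₁ hP hP0 ⊢
    nlinarith [mul_nonneg hε.le hHd]
  · have h1 : (N₂ : ℝ) < (1 + H / d) / (1 - ε) + 1 := Nat.ceil_lt_add_one (by positivity)
    have h2 : (1 + H / d) / (1 - ε) ≤ (1 + H / d) * (1 + 2 * ε) := by
      rw [div_le_iff₀ hε1, mul_assoc]
      refine le_mul_of_one_le_right (by positivity) ?_
      nlinarith
    nlinarith

/-! ### Height of a packing -/

theorem packingHeight_le_iff {P : List PlacedRect} {H : ℝ} :
    packingHeight P ≤ H ↔ 0 ≤ H ∧ ∀ p ∈ P, p.top ≤ H := by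
  unfold packingHeight
  induction P with
  | nil => simp
  | cons p P ih =>
    simp only [List.map_cons, List.foldr_cons, max_le_iff, List.forall_mem_cons, ih]
    tauto

theorem packingHeight_nonneg (P : List PlacedRect) : 0 ≤ packingHeight P :=
  (packingHeight_le_iff.1 le_rfl).1

theorem top_le_packingHeight {P : List PlacedRect} {p : PlacedRect} (hp : p ∈ P) :
    p.top ≤ packingHeight P :=
  (packingHeight_le_iff.1 le_rfl).2 p hp

theorem stripOPT_le_packingHeight {L : List Rect} {P : List PlacedRect}
    (hP : IsStripPacking L P) : stripOPT L ≤ packingHeight P :=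
  csInf_le ⟨0, fun _ ⟨Q, _, hQ⟩ => hQ ▸ packingHeight_nonneg Q⟩ ⟨P, hP, rfl⟩

theorem PlacedRect.NonOverlapping.symm {p q : PlacedRect} (h : p.NonOverlapping q) :
    q.NonOverlapping p := by
  unfold PlacedRect.NonOverlapping at *
  tauto

/-- The rectangles met by a horizontal line have total width at most `1`. -/
theorem sum_width_active_le_one {ι : Type*} [Fintype ι] (p : ι → PlacedRect)
    (hin : ∀ i, (p i).InStrip) (hno : Pairwise fun i j => (p i).NonOverlapping (p j)) (t : ℝ) :
    ∑ i with t ∈ Set.Ico (p i).y ((p i).y + (p i).rect.height), ((p i).rect.width : ℝ) ≤ 1 := by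
  classical
  set s := Finset.univ.filter fun i => t ∈ Set.Ico (p i).y ((p i).y + (p i).rect.height)
  have hvol : ∀ i, volume.real (Set.Ico (p i).x (p i).right) = (p i).rect.width := by
    intro i
    have := (p i).rect.width.2.1.le
    simp [PlacedRect.right, this]
  have hdisj : (s : Set ι).PairwiseDisjoint fun i => Set.Ico (p i).x (p i).right := by
    intro i hi j hj hij
    have hi := (Finset.mem_filter.1 hi).2
    have hj := (Finset.mem_filter.1 hj).2
    have := hno hij
    unfold PlacedRect.NonOverlapping PlacedRect.top at this
    rw [Function.onFun, Set.disjoint_left]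
    rintro a ⟨h1, h2⟩ ⟨h3, h4⟩
    rcases this with h | h | h | h
    · linarith
    · linarith
    · linarith [hi.2, hj.1]
    · linarith [hj.2, hi.1]
  calc ∑ i ∈ s, ((p i).rect.width : ℝ) = volume.real (⋃ i ∈ s, Set.Ico (p i).x (p i).right) := by
        rw [measureReal_biUnion_finset hdisj (fun _ _ => measurableSet_Ico)
          (fun _ _ => measure_Ico_lt_top.ne)]
        exact Finset.sum_congr rfl fun i _ => (hvol i).symm
    _ ≤ volume.real (Set.Icc (0 : ℝ) 1) := by
        refine measureReal_mono (Set.iUnion₂_subset fun i _ a ha => ?_) (by simp)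
        obtain ⟨h1, h2, -⟩ := hin i
        exact ⟨h1.trans ha.1, ha.2.le.trans h2⟩
    _ = 1 := by simp

/-! ### Batching into slips -/

namespace Slip

theorem rects_push (s : Slip) (r : Rect) : (s.push r).rects = s.rects ++ [r] := rfl

theorem packedHeight_push (s : Slip) (r : Rect) :
    (s.push r).packedHeight = s.packedHeight + r.height := by
  simp [packedHeight, rects_push]

end Slip

theorem flatMap_rects_batch (c : ℝ) (s : Slip) (rs : List Rect) :
    (batch c s rs).1.flatMap Slip.rects ++ (batch c s rs).2.rects = s.rects ++ rs := by
  induction rs generalizing s with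
  | nil => simp [batch]
  | cons r rs ih =>
    rw [batch]
    split_ifs
    · rw [ih, Slip.rects_push, List.append_assoc, List.singleton_append]
    · simp only [List.flatMap_cons, List.append_assoc, ih]
      rfl

theorem packedHeight_batch_le {c : ℝ} (hc : 1 ≤ c) (s : Slip) (rs : List Rect)
    (hs : s.packedHeight ≤ c) :
    (∀ t ∈ (batch c s rs).1, t.packedHeight ≤ c) ∧ (batch c s rs).2.packedHeight ≤ c := by
  induction rs generalizing s with
  | nil => simpa [batch] using hs
  | cons r rs ih =>
    rw [batch]
    split_ifs with h
    · exact ih _ (by rwa [Slip.packedHeight_push])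
    · have := ih ⟨r, []⟩ (by simpa [Slip.packedHeight, Slip.rects] using r.height.2.2.trans hc)
      exact ⟨List.forall_mem_cons.2 ⟨hs, this.1⟩, this.2⟩

/-- A slip is closed only when the next rectangle, of height at most `1`, does not fit. -/
theorem lt_packedHeight_batch (c : ℝ) (s : Slip) (rs : List Rect) :
    ∀ t ∈ (batch c s rs).1, c - 1 < t.packedHeight := by
  induction rs generalizing s with
  | nil => simp [batch]
  | cons r rs ih =>
    rw [batch]
    split_ifs with h
    · exact ih _
    · refine List.forall_mem_cons.2 ⟨?_, ih _⟩
      have := r.height.2.2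
      linarith

theorem sortByWidth_perm (L : List Rect) : (sortByWidth L).Perm L := List.perm_insertionSort _ L

theorem pairwise_sortByWidth (L : List Rect) :
    (sortByWidth L).Pairwise fun r s => s.width ≤ r.width := by
  have : Std.Total fun r s : Rect => s.width ≤ r.width := ⟨fun _ _ => le_total _ _⟩
  have : IsTrans Rect fun r s : Rect => s.width ≤ r.width := ⟨fun _ _ _ h1 h2 => h2.trans h1⟩
  exact List.pairwise_insertionSort _ L

/-- The slips that are closed when the rectangles `L` are batched, in order. -/
noncomputable def closedSlips (c : ℝ) (L : List Rect) : List Slip :=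
  match sortByWidth L with
  | [] => []
  | r :: rs => (batch c ⟨r, []⟩ rs).1

/-- The widths of the closed slips, i.e. the bin packing instance that batch-and-pack solves. -/
noncomputable def slipWidths (c : ℝ) (L : List Rect) : List Size :=
  (closedSlips c L).map Slip.width

/-! ### Placing the slips -/

theorem map_rect_stack (x y : ℝ) (l : List Rect) : (stack x y l).map PlacedRect.rect = l := by
  induction l generalizing y with
  | nil => rfl
  | cons r l ih => simp [stack, ih]

theorem of_mem_stack {x y : ℝ} {l : List Rect} {p : PlacedRect} (hp : p ∈ stack x y l) :
    p.x = x ∧ y ≤ p.y ∧ p.top ≤ y + (l.map fun r => (r.height : ℝ)).sum ∧ p.rect ∈ l := by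
  induction l generalizing y with
  | nil => simp [stack] at hp
  | cons r l ih =>
    have hr := r.height.2.1
    have hl : 0 ≤ (l.map fun r => (r.height : ℝ)).sum :=
      List.sum_nonneg fun a ha => by
        obtain ⟨r, -, rfl⟩ := List.mem_map.1 ha
        exact r.height.2.1.le
    rw [stack, List.mem_cons] at hp
    rw [List.map_cons, List.sum_cons, List.mem_cons]
    rcases hp with rfl | hp
    · exact ⟨rfl, le_rfl, by simp only [PlacedRect.top]; linarith, Or.inl rfl⟩
    · obtain ⟨h1, h2, h3, h4⟩ := ih hp
      exact ⟨h1, by linarith, by linarith, Or.inr h4⟩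

theorem pairwise_stack (x y : ℝ) (l : List Rect) :
    (stack x y l).Pairwise PlacedRect.NonOverlapping := by
  induction l generalizing y with
  | nil => exact List.Pairwise.nil
  | cons r l ih =>
    refine List.Pairwise.cons (fun p hp => ?_) (ih _)
    exact Or.inr (Or.inr (Or.inl (of_mem_stack hp).2.1))

namespace BinPacking

variable {l : List Size} (P : BinPacking l)

theorem offset_nonneg (k : Fin l.length) : 0 ≤ P.offset k :=
  Finset.sum_nonneg fun j _ => (l.get j).2.1.le

theorem offset_add_le {k : Fin l.length} {T : Finset (Fin l.length)} (hk : k ∈ T)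
    (hT : ∀ j, j < k → P.bin j = P.bin k → j ∈ T) :
    P.offset k + l.get k ≤ ∑ j ∈ T, (l.get j : ℝ) := by
  classical
  have hnot : k ∉ Finset.univ.filter fun j => j < k ∧ P.bin j = P.bin k := by simp
  have hsum := Finset.sum_insert (f := fun j => (l.get j : ℝ)) hnot
  rw [offset, add_comm]
  refine hsum.symm.trans_le ?_
  refine Finset.sum_le_sum_of_subset_of_nonneg (Finset.insert_subset hk fun j hj => ?_)
    fun j _ _ => (l.get j).2.1.le
  have := (Finset.mem_filter.1 hj).2
  exact hT j this.1 this.2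

theorem offset_add_le_one (k : Fin l.length) : P.offset k + l.get k ≤ 1 :=
  (P.offset_add_le (by simp) (by simp)).trans (P.capacity (P.bin k))

theorem offset_add_le_offset {j k : Fin l.length} (hjk : j < k) (hb : P.bin j = P.bin k) :
    P.offset j + l.get j ≤ P.offset k := by
  refine P.offset_add_le (by simp [hjk, hb]) fun i hij hi => ?_
  simp [hij.trans hjk, hi.trans hb]

end BinPacking

section packSlips

variable (A : BinPackingAlgorithm) {c : ℝ} {S : List Slip} (last : Slip)

/-- The rectangles of a slip stay inside the box of height `c` that its bin and offset reserve. -/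
theorem of_mem_stack_slip (hw : ∀ s ∈ S, ∀ r ∈ s.rects, r.width ≤ s.width)
    (hh : ∀ s ∈ S, s.packedHeight ≤ c) (P : BinPacking (S.map Slip.width)) (k : Fin S.length)
    (i : Fin (S.map Slip.width).length) (hi : (i : ℕ) = k) {p : PlacedRect}
    (hp : p ∈ stack (P.offset i) ((P.bin i : ℕ) * c) (S.get k).rects) :
    p.x = P.offset i ∧ p.right ≤ P.offset i + (S.map Slip.width).get i ∧
      (P.bin i : ℕ) * c ≤ p.y ∧ p.top ≤ ((P.bin i : ℕ) + 1) * c := by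
  obtain ⟨h1, h2, h3, h4⟩ := of_mem_stack hp
  have hget : (S.map Slip.width).get i = (S.get k).width := by simp [hi]
  have hmem : S.get k ∈ S := List.get_mem S k
  have hwid : (p.rect.width : ℝ) ≤ (S.get k).width := hw _ hmem _ h4
  have hhei : ((S.get k).rects.map fun r => (r.height : ℝ)).sum ≤ c := hh _ hmem
  refine ⟨h1, ?_, h2, by linarith⟩
  rw [hget, PlacedRect.right, h1]
  linarith

theorem of_mem_packSlips (hc : 0 ≤ c) (hw : ∀ s ∈ S, ∀ r ∈ s.rects, r.width ≤ s.width)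
    (hh : ∀ s ∈ S, s.packedHeight ≤ c) :
    ∀ p ∈ packSlips A c S last, p.InStrip ∧
      p.top ≤ (A (S.map Slip.width)).numBins * c + last.packedHeight := by
  intro p hp
  have hlast : 0 ≤ last.packedHeight := List.sum_nonneg fun a ha => by
    obtain ⟨r, -, rfl⟩ := List.mem_map.1 ha
    exact r.height.2.1.le
  rcases List.mem_append.1 hp with hp | hp
  · obtain ⟨k, -, hk⟩ := List.mem_flatMap.1 hp
    set P := A (S.map Slip.width)
    set i : Fin (S.map Slip.width).length := k.cast (List.length_map _).symm
    obtain ⟨h1, h2, h3, h4⟩ := of_mem_stack_slip hw hh P k i rfl hk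
    have h5 := P.offset_nonneg i
    have h6 := P.offset_add_le_one i
    have h7 : ((P.bin i : ℕ) : ℝ) + 1 ≤ P.numBins := by exact_mod_cast (P.bin i).is_lt
    have h8 : (((P.bin i : ℕ) : ℝ) + 1) * c ≤ P.numBins * c := by gcongr
    have h9 : 0 ≤ ((P.bin i : ℕ) : ℝ) * c := by positivity
    exact ⟨⟨by linarith, by linarith, by linarith⟩, by linarith⟩
  · obtain ⟨h1, h2, h3, -⟩ := of_mem_stack hp
    have h4 := p.rect.width.2.2
    have h5 : 0 ≤ ((A (S.map Slip.width)).numBins : ℝ) * c := by positivity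
    exact ⟨⟨h1.ge, by rw [PlacedRect.right, h1]; linarith, h5.trans h2⟩, h3⟩

theorem isStripPacking_packSlips (hc : 0 ≤ c) (hw : ∀ s ∈ S, ∀ r ∈ s.rects, r.width ≤ s.width)
    (hh : ∀ s ∈ S, s.packedHeight ≤ c) :
    IsStripPacking (S.flatMap Slip.rects ++ last.rects) (packSlips A c S last) := by
  refine ⟨?_, fun p hp => (of_mem_packSlips A last hc hw hh p hp).1, ?_⟩
  · have : (packSlips A c S last).map PlacedRect.rect = S.flatMap Slip.rects ++ last.rects := by
      simp only [packSlips, List.map_append, List.map_flatMap, map_rect_stack]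
      congr 1
      conv_rhs => rw [← List.map_get_finRange S, List.flatMap_map]
    rw [this]
  · rw [packSlips]
    set P := A (S.map Slip.width)
    refine List.pairwise_append.2 ⟨List.pairwise_flatMap.2 ⟨fun k _ => pairwise_stack _ _ _, ?_⟩,
      pairwise_stack _ _ _, ?_⟩
    · refine (List.pairwise_lt_finRange _).imp fun {j k} hjk p hp q hq => ?_
      set ij : Fin (S.map Slip.width).length := j.cast (List.length_map _).symm
      set ik : Fin (S.map Slip.width).length := k.cast (List.length_map _).symm
      obtain ⟨-, h2, h3, h4⟩ := of_mem_stack_slip hw hh P j ij rfl hp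
      obtain ⟨h5, -, h7, h8⟩ := of_mem_stack_slip hw hh P k ik rfl hq
      have hmono : ∀ a b : ℕ, a < b → ((a : ℝ) + 1) * c ≤ b * c := fun a b hab => by
        have : (a : ℝ) + 1 ≤ b := by exact_mod_cast hab
        gcongr
      rcases lt_trichotomy (P.bin ij) (P.bin ik) with hlt | heq | hgt
      · exact Or.inr (Or.inr (Or.inl ((h4.trans (hmono _ _ hlt)).trans h7)))
      · have := P.offset_add_le_offset (show ij < ik from hjk) heq
        exact Or.inl (by linarith)
      · exact Or.inr (Or.inr (Or.inr ((h8.trans (hmono _ _ hgt)).trans h3)))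
    · intro p hp q hq
      obtain ⟨k, -, hk⟩ := List.mem_flatMap.1 hp
      obtain ⟨-, -, -, h4⟩ := of_mem_stack_slip hw hh P k _ rfl hk
      refine Or.inr (Or.inr (Or.inl (h4.trans (le_trans ?_ (of_mem_stack hq).2.1))))
      have : ((P.bin (k.cast (List.length_map _).symm) : ℕ) : ℝ) + 1 ≤ P.numBins := by
        exact_mod_cast (P.bin (k.cast (List.length_map _).symm)).is_lt
      gcongr

end packSlips

/-- The last slip is not empty, so it ends above all layers. -/
theorem numBins_mul_le_packingHeight_packSlips (A : BinPackingAlgorithm) (c : ℝ) (S : List Slip)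
    (last : Slip) :
    (A (S.map Slip.width)).numBins * c ≤ packingHeight (packSlips A c S last) := by
  set P := A (S.map Slip.width) with hP
  have hmem : (⟨last.first, 0, P.numBins * c⟩ : PlacedRect) ∈ packSlips A c S last := by
    refine List.mem_append_right _ ?_
    simp only [Slip.rects, stack, List.mem_cons]
    exact Or.inl rfl
  refine le_trans ?_ (top_le_packingHeight hmem)
  exact le_add_of_nonneg_right last.first.height.2.1.le

/-- Batch-and-pack is feasible, and its height is determined, up to `c`, by the number of bins that
`A` uses for the slip widths. For `L ≠ []` the last slip exists and lies above all layers, whence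
the lower bound. -/
theorem batchAndPack_spec (A : BinPackingAlgorithm) {c : ℝ} (hc : 1 < c) (L : List Rect) :
    IsStripPacking L (batchAndPack A c L) ∧
      packingHeight (batchAndPack A c L) ≤ (A (slipWidths c L)).numBins * c + c ∧
      (L ≠ [] → (A (slipWidths c L)).numBins * c ≤ packingHeight (batchAndPack A c L)) := by
  have hperm := sortByWidth_perm L
  have hsort := pairwise_sortByWidth L
  rw [batchAndPack, slipWidths, closedSlips]
  rcases hL : sortByWidth L with _ | ⟨r, rs⟩
  · rw [hL] at hperm
    obtain rfl := hperm.nil_eq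
    refine ⟨⟨.nil, by simp, .nil⟩, ?_, fun h => absurd rfl h⟩
    have h0 : packingHeight [] = 0 := rfl
    rw [h0]
    positivity
  rw [hL] at hperm hsort
  set B := batch c ⟨r, []⟩ rs
  have hflat : B.1.flatMap Slip.rects ++ B.2.rects = r :: rs := flatMap_rects_batch c ⟨r, []⟩ rs
  have hh := packedHeight_batch_le hc.le ⟨r, []⟩ rs
    (by simpa [Slip.packedHeight, Slip.rects] using r.height.2.2.trans hc.le)
  have hw : ∀ s ∈ B.1, ∀ r ∈ s.rects, r.width ≤ s.width := by
    rw [← hflat] at hsort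
    intro s hs r' hr'
    have h1 := (List.pairwise_flatMap.1 (List.pairwise_append.1 hsort).1).1 s hs
    rcases List.mem_cons.1 hr' with rfl | h
    · exact le_rfl
    · exact (List.pairwise_cons.1 h1).1 r' h
  have hc0 : 0 ≤ c := by linarith
  have hP := isStripPacking_packSlips A B.2 hc0 hw hh.1
  rw [hflat] at hP
  refine ⟨⟨hP.perm.trans hperm, hP.inStrip, hP.nonOverlapping⟩, ?_,
    fun _ => numBins_mul_le_packingHeight_packSlips A c B.1 B.2⟩
  refine packingHeight_le_iff.2 ⟨by positivity, fun p hp => ?_⟩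
  have h1 := (of_mem_packSlips A B.2 hc0 hw hh.1 p hp).2
  have h2 : B.2.packedHeight ≤ c := hh.2
  simp only
  linarith

/-- Batch-and-pack with an optimal bin packing algorithm. -/
theorem stripOPT_le_binOPT_slipWidths {c : ℝ} (hc : 1 < c) (L : List Rect) :
    stripOPT L ≤ binOPT (slipWidths c L) * c + c := by
  choose A hA using exists_optimal_binPacking
  obtain ⟨h1, h2, -⟩ := batchAndPack_spec A hc L
  rw [hA] at h2
  exact (stripOPT_le_packingHeight h1).trans h2

/-! ### Comparison of the two optima -/

theorem exists_eq_flatten_of_map_eq_flatten {α β : Type*} {f : α → β} {l : List α}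
    {M : List (List β)} (h : l.map f = M.flatten) :
    ∃ N : List (List α), l = N.flatten ∧ N.map (List.map f) = M := by
  induction M generalizing l with
  | nil => exact ⟨[], by simpa using h, rfl⟩
  | cons m M ih =>
    rw [List.flatten_cons, List.map_eq_append_iff] at h
    obtain ⟨l₁, l₂, rfl, rfl, h2⟩ := h
    obtain ⟨N, rfl, rfl⟩ := ih h2
    exact ⟨l₁ :: N, by simp, by simp⟩

theorem exists_flatMap_closedSlips_append (c : ℝ) (L : List Rect) :
    ∃ R, (closedSlips c L).flatMap Slip.rects ++ R = sortByWidth L := by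
  rw [closedSlips]
  rcases sortByWidth L with _ | ⟨r, rs⟩
  · exact ⟨[], rfl⟩
  · exact ⟨_, flatMap_rects_batch c ⟨r, []⟩ rs⟩

theorem lt_packedHeight_closedSlips (c : ℝ) (L : List Rect) :
    ∀ s ∈ closedSlips c L, c - 1 < s.packedHeight := by
  rw [closedSlips]
  rcases sortByWidth L with _ | ⟨r, rs⟩
  · simp
  · exact lt_packedHeight_batch c ⟨r, []⟩ rs

/-- The rectangles of any strip packing, sorted by width and cut into slips, meet the hypotheses of
`exists_fitsInBins_of_slips`; the last slip is left out. -/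
theorem binOPT_slipWidths_le_packingHeight {c ε : ℝ} (hc : 1 < c) (hε : 0 < ε) (hε2 : ε ≤ 1 / 2)
    {L : List Rect} {P : List PlacedRect} (hP : IsStripPacking L P) :
    (binOPT (slipWidths c L) : ℝ) ≤
      (1 + 2 * ε) * (packingHeight P / (c - 1)) + roundingConstant ε := by
  classical
  obtain ⟨R, hR⟩ := exists_flatMap_closedSlips_append c L
  have hlt := lt_packedHeight_closedSlips c L
  have hsort := pairwise_sortByWidth L
  rw [slipWidths]
  set S := closedSlips c L
  have hflat : (S.map Slip.rects ++ [R]).flatten = sortByWidth L := by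
    simpa [List.flatMap] using hR
  obtain ⟨P', hP', hmap⟩ := (hP.perm.trans (sortByWidth_perm L).symm).exists_perm_map_eq
  rw [← hflat] at hmap hsort
  obtain ⟨Q, rfl, hQ⟩ := exists_eq_flatten_of_map_eq_flatten hmap
  have hno := (hP'.pairwise_iff PlacedRect.NonOverlapping.symm).2 hP.nonOverlapping
  have hmemP : ∀ k : Fin Q.length, ∀ p ∈ Q.get k, p ∈ P := fun k p hp =>
    hP'.mem_iff.1 (List.mem_flatten.2 ⟨_, List.get_mem Q k, hp⟩)
  have hlen : Q.length = S.length + 1 := by simpa using congrArg List.length hQ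
  -- the `k`-th part of the packing consists of the rectangles of the `k`-th slip
  have hQk : ∀ (k : Fin Q.length) (hk : (k : ℕ) < S.length),
      (Q.get k).map PlacedRect.rect = (S[(k : ℕ)]).rects := by
    intro k hk
    have := congrArg (fun l => l[(k : ℕ)]?) hQ
    simpa [List.getElem?_append_left, hk] using this
  -- rectangles of a slip are at least as wide as the later slips
  have hwide : ∀ (k : Fin Q.length) (j : ℕ) (hj : j < S.length), (k : ℕ) < j →
      ∀ p ∈ Q.get k, (S[j]).width ≤ p.rect.width := by
    intro k j hj hkj p hp
    have hk : (k : ℕ) < S.length := hkj.trans hj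
    have h1 := (List.pairwise_append.1 (List.pairwise_flatten.1 hsort).2).1
    rw [List.pairwise_map, List.pairwise_iff_getElem] at h1
    refine h1 k j hk hj hkj _ ?_ _ (List.mem_cons_self)
    rw [← hQk k hk]
    exact List.mem_map_of_mem hp
  have hanti : ∀ j k (hj : j < S.length) (hk : k < S.length), j ≤ k →
      (S[k]).width ≤ (S[j]).width := by
    intro j k hj hk hjk
    rcases hjk.eq_or_lt with rfl | hjk
    · exact le_rfl
    have h1 := (List.pairwise_append.1 (List.pairwise_flatten.1 hsort).2).1
    rw [List.pairwise_map, List.pairwise_iff_getElem] at h1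
    exact h1 j k hj hk hjk _ List.mem_cons_self _ List.mem_cons_self
  let ι := Σ k : Fin Q.length, Fin (Q.get k).length
  let p : ι → PlacedRect := fun i => (Q.get i.1).get i.2
  have hpP : ∀ i, p i ∈ P := fun i => hmemP i.1 _ (List.get_mem _ _)
  have hpno : Pairwise fun i j => (p i).NonOverlapping (p j) := by
    obtain ⟨h1, h2⟩ := List.pairwise_flatten.1 hno
    rw [List.pairwise_iff_getElem] at h2
    rintro ⟨k, i⟩ ⟨k', i'⟩ hne
    rcases lt_trichotomy k k' with hlt | rfl | hgt
    · exact h2 k k' k.2 k'.2 hlt _ (List.get_mem _ _) _ (List.get_mem _ _)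
    · have h3 := List.pairwise_iff_getElem.1 (h1 _ (List.get_mem Q k))
      have hne' : i ≠ i' := fun h => hne (by rw [h])
      rcases lt_or_gt_of_ne hne' with h | h
      · exact h3 i i' i.2 i'.2 h
      · exact (h3 i' i i'.2 i.2 h).symm
    · exact (h2 k' k k'.2 k.2 hgt _ (List.get_mem _ _) _ (List.get_mem _ _)).symm
  let W : ℕ → ℝ := fun k => if hk : k < S.length then ((S[k]).width : ℝ) else 0
  have hW : ∀ k (hk : k < S.length), W k = (S[k]).width := fun k hk => dif_pos hk
  obtain ⟨N, hN, hfit⟩ := exists_fitsInBins_of_slips (ι := ι) (y := fun i => (p i).y)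
    (h := fun i => (p i).rect.height) (w := fun i => (p i).rect.width) (H := packingHeight P)
    (m := S.length) (sub_pos.2 hc) hε hε2 (packingHeight_nonneg P)
    (fun i => (hP.inStrip _ (hpP i)).2.2) (fun i => (p i).rect.height.2.1.le)
    (fun i => top_le_packingHeight (hpP i)) (fun i => (p i).rect.width.2.1.le)
    (sum_width_active_le_one p (fun i => hP.inStrip _ (hpP i)) hpno)
    (fun i => i.1) W
    (fun k hk => by rw [hW k hk]; exact (S[k]).width.2.1)
    (fun k hk => by rw [hW k hk]; exact (S[k]).width.2.2)
    (fun j k hjk hk => by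
      rw [hW k hk, hW j (hjk.trans_lt hk)]
      exact hanti j k _ hk hjk)
    (fun i k hik hk => by
      rw [hW k hk]
      exact hwide i.1 k hk hik _ (List.get_mem _ _))
    (fun k hk => by
      refine (hlt _ (List.getElem_mem hk)).le.trans_eq ?_
      let k' : Fin Q.length := ⟨k, by omega⟩
      rw [Finset.sum_filter, Fintype.sum_sigma,
        Finset.sum_eq_single_of_mem k' (Finset.mem_univ _)]
      · rw [Slip.packedHeight, ← hQk k' hk, List.map_map]
        simp only [k', if_true]
        exact (Fin.sum_univ_fun_getElem (Q.get k') fun q => (q.rect.height : ℝ)).symm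
      · intro j _ hj
        refine Finset.sum_eq_zero fun i _ => if_neg fun h => hj (Fin.ext h))
  refine le_trans ?_ hN
  have hle : binOPT (S.map Slip.width) ≤ N := binOPT_le_of_fitsInBins
    (hfit.of_injOn (fun k => (k : ℕ)) (fun _ _ _ _ h => Fin.ext h)
      (fun k _ => by simpa using k.2)
      (fun k _ => by
        have hk : (k : ℕ) < S.length := by simpa using k.2
        rw [hW k hk]
        simp)
      (fun k hk => by
        rw [hW k (Finset.mem_range.1 hk)]
        exact (S[k]'(Finset.mem_range.1 hk)).width.2.1.le))
  exact_mod_cast hle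

/-- For large `c` and small `ε`, the layers of an optimal bin packing of the slips are hardly higher
than an optimal strip packing, up to an additive constant for fixed `c` and `ε`. -/
theorem binOPT_slipWidths_le {c ε : ℝ} (hc : 1 < c) (hε : 0 < ε) (hε2 : ε ≤ 1 / 2)
    (L : List Rect) :
    (binOPT (slipWidths c L) : ℝ) ≤
      (1 + 2 * ε) * (stripOPT L / (c - 1)) + roundingConstant ε := by
  have hd : 0 < c - 1 := sub_pos.2 hc
  have hk : 0 < (1 + 2 * ε) / (c - 1) := by positivity
  choose A _ using exists_optimal_binPacking
  have hle : ((binOPT (slipWidths c L) : ℝ) - roundingConstant ε) / ((1 + 2 * ε) / (c - 1)) ≤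
      stripOPT L := by
    refine le_csInf ⟨_, _, (batchAndPack_spec A hc L).1, rfl⟩ ?_
    rintro H ⟨P, hP, rfl⟩
    rw [div_le_iff₀ hk]
    have := binOPT_slipWidths_le_packingHeight hc hε hε2 hP
    calc _ ≤ (1 + 2 * ε) * (packingHeight P / (c - 1)) := by linarith
      _ = _ := by ring
  rw [div_le_iff₀ hk] at hle
  calc (binOPT (slipWidths c L) : ℝ)
      ≤ stripOPT L * ((1 + 2 * ε) / (c - 1)) + roundingConstant ε := by linarith
    _ = _ := by ring

/-! ### Every bin packing instance is an instance of slip widths -/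

/-- The rectangles `r` fill the open slip up to height exactly `c`, so the next one closes it. -/
theorem map_width_batch_replicate {c : ℝ} (s : Slip) (r r' : Rect) (rs : List Rect) (j : ℕ)
    (hs : s.packedHeight + j * r.height = c) :
    (batch c s (List.replicate j r ++ r' :: rs)).1.map Slip.width =
      s.width :: (batch c ⟨r', []⟩ rs).1.map Slip.width := by
  induction j generalizing s with
  | zero =>
    have := r'.height.2.1
    have h : ¬ s.packedHeight + r'.height ≤ c := by
      push_cast at hs
      linarith
    simp [batch, h]
  | succ j ih =>
    have := r.height.2.1
    push_cast at hs
    have h : s.packedHeight + r.height ≤ c := by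
      have : 0 ≤ (j : ℝ) * r.height := by positivity
      linarith
    rw [List.replicate_succ, List.cons_append, batch, if_pos h,
      ih _ (by rw [Slip.packedHeight_push]; linarith)]
    rfl

theorem map_width_batch_flatMap_replicate {c : ℝ} (h t : Size) (j : ℕ) (hj : (j + 1) * (h : ℝ) = c)
    (l : List Size) :
    ∃ r rs, l.flatMap (fun s => List.replicate (j + 1) ⟨s, h⟩) ++ [⟨t, h⟩] = r :: rs ∧
      (batch c ⟨r, []⟩ rs).1.map Slip.width = l := by
  induction l with
  | nil => exact ⟨_, _, rfl, rfl⟩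
  | cons s l ih =>
    obtain ⟨r, rs, h1, h2⟩ := ih
    refine ⟨⟨s, h⟩, List.replicate j ⟨s, h⟩ ++ r :: rs, ?_, ?_⟩
    · rw [List.flatMap_cons, List.append_assoc, h1, List.replicate_succ, List.cons_append]
    · rw [map_width_batch_replicate _ _ _ _ _ ?_, h2]
      · rfl
      · simp only [Slip.packedHeight, Slip.rects, List.map_cons, List.map_nil, List.sum_cons,
          List.sum_nil]
        linarith

theorem exists_le_forall_mem (l : List Size) : ∃ t : Size, ∀ s ∈ l, t ≤ s := by
  induction l with
  | nil => exact ⟨⟨1, by norm_num, le_rfl⟩, by simp⟩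
  | cons s l ih =>
    obtain ⟨t, ht⟩ := ih
    refine ⟨min t s, List.forall_mem_cons.2 ⟨min_le_right _ _, fun s' hs' => ?_⟩⟩
    exact (min_le_left _ _).trans (ht s' hs')

/-- The slips are filled exactly, by `⌈c⌉` rectangles of height `c / ⌈c⌉` each. One more rectangle,
at most as wide as all others, is the last slip. -/
theorem exists_slipWidths_perm {c : ℝ} (hc : 1 < c) (l : List Size) :
    ∃ L : List Rect, L ≠ [] ∧ (slipWidths c L).Perm l := by
  set l' := l.insertionSort (· ≥ ·) with hl'
  have hsort : l'.Pairwise (· ≥ ·) := List.pairwise_insertionSort _ _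
  obtain ⟨t, ht⟩ := exists_le_forall_mem l'
  obtain ⟨j, hj⟩ : ∃ j, ⌈c⌉₊ = j + 1 :=
    Nat.exists_eq_succ_of_ne_zero (Nat.ceil_pos.2 (by linarith)).ne'
  have hcj : c ≤ (j : ℝ) + 1 := by
    have := Nat.le_ceil c
    rw [hj] at this
    exact_mod_cast this
  have hj0 : (0 : ℝ) < j + 1 := by positivity
  let h : Size := ⟨c / (j + 1), by positivity, (div_le_one hj0).2 hcj⟩
  obtain ⟨r, rs, h1, h2⟩ := map_width_batch_flatMap_replicate (c := c) h t j
    (mul_div_cancel₀ c hj0.ne') l'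
  have hL : sortByWidth (r :: rs) = r :: rs := by
    refine List.Pairwise.insertionSort_eq ?_
    rw [← h1]
    refine List.pairwise_append.2 ⟨List.pairwise_flatMap.2 ⟨fun s _ => ?_, ?_⟩, by simp, ?_⟩
    · exact List.pairwise_replicate.2 (Or.inr le_rfl)
    · refine hsort.imp fun {s s'} hss x hx y hy => ?_
      rw [List.eq_of_mem_replicate hx, List.eq_of_mem_replicate hy]
      exact hss
    · intro x hx y hy
      obtain ⟨s, hs, hx⟩ := List.mem_flatMap.1 hx
      rw [List.eq_of_mem_replicate hx, List.mem_singleton.1 hy]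
      exact ht s hs
  refine ⟨r :: rs, by simp, ?_⟩
  rw [slipWidths, closedSlips, hL]
  exact (List.Perm.of_eq h2).trans (List.perm_insertionSort _ l)

/-! ### Comparison of the asymptotic ratios -/

theorem exists_forall_cost_le_of_asymptoticRatio_lt {ι : Type} {cost opt : ι → ℝ} {ρ : ℝ}
    (h : asymptoticRatio cost opt < ENNReal.ofReal ρ) :
    ∃ N : ℝ, ∀ L, N ≤ opt L → cost L ≤ ρ * opt L := by
  obtain ⟨N, hN⟩ := eventually_atTop.1 (eventually_lt_of_limsup_lt h)
  refine ⟨max N 1, fun L hL => ?_⟩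
  have h1 : ENNReal.ofReal (cost L / opt L) < ENNReal.ofReal ρ :=
    (le_iSup₂ (f := fun (L' : ι) (_ : opt L' = opt L) => ENNReal.ofReal (cost L' / opt L'))
      L rfl).trans_lt (hN _ ((le_max_left _ _).trans hL))
  have h2 : cost L / opt L < ρ := (ENNReal.ofReal_lt_ofReal_iff'.1 h1).1
  have h3 : 0 < opt L := zero_lt_one.trans_le ((le_max_right _ _).trans hL)
  exact ((div_lt_iff₀ h3).1 h2).le

theorem asymptoticRatio_le_of_forall {ι : Type} {cost opt : ι → ℝ} {ρ N : ℝ}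
    (h : ∀ L, N ≤ opt L → cost L / opt L ≤ ρ) : asymptoticRatio cost opt ≤ ENNReal.ofReal ρ := by
  refine limsup_le_of_le (by isBoundedDefault) (eventually_atTop.2 ⟨N, fun n hn => ?_⟩)
  refine iSup₂_le fun L hL => ENNReal.ofReal_le_ofReal (h L (hL ▸ hn))

theorem exists_lt_cost_div_of_lt_asymptoticRatio {ι : Type} {cost opt : ι → ℝ} {ρ : ℝ}
    (h : ENNReal.ofReal ρ < asymptoticRatio cost opt) (N : ℝ) :
    ∃ L, N ≤ opt L ∧ ρ < cost L / opt L := by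
  obtain ⟨n, hn, hlt⟩ := frequently_atTop.1
    (frequently_lt_of_lt_limsup (by isBoundedDefault) h) N
  obtain ⟨L, hL⟩ := lt_iSup_iff.1 hlt
  obtain ⟨hLn, hL⟩ := lt_iSup_iff.1 hL
  exact ⟨L, hn.trans_eq hLn.symm, (ENNReal.ofReal_lt_ofReal_iff'.1 hL).1⟩

theorem le_asymptoticRatio_of_forall_exists {ι : Type} {cost opt : ι → ℝ} {ρ : ℝ}
    (h : ∀ N, ∃ L, N ≤ opt L ∧ ρ ≤ cost L / opt L) :
    ENNReal.ofReal ρ ≤ asymptoticRatio cost opt := by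
  refine le_limsup_of_frequently_le (frequently_atTop.2 fun N => ?_) (by isBoundedDefault)
  obtain ⟨L, hN, hL⟩ := h N
  exact ⟨opt L, hN, (ENNReal.ofReal_le_ofReal hL).trans
    (le_iSup₂ (f := fun (L' : ι) (_ : opt L' = opt L) => ENNReal.ofReal (cost L' / opt L'))
      L rfl)⟩

/-- For fixed `c`, the bin packing instance that `A` has to solve has a large optimum when `stripOPT`
is large, so that the asymptotic guarantee of `A` applies to it. -/
theorem stripRatio_batchAndPack_le (A : BinPackingAlgorithm) {c ρ ε : ℝ} (hc : 1 < c)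
    (hρ : A.ratio < ENNReal.ofReal ρ) (hε : 0 < ε) (hε2 : ε ≤ 1 / 2) :
    stripRatio (batchAndPack A c) ≤
      ENNReal.ofReal (ρ * (1 + 2 * ε) * (c / (c - 1)) + ε) := by
  have hρ0 : 0 < ρ := ENNReal.ofReal_pos.1 (bot_le.trans_lt hρ)
  obtain ⟨N, hN⟩ := exists_forall_cost_le_of_asymptoticRatio_lt hρ
  set K := roundingConstant ε
  have hc0 : 0 < c := by linarith
  refine asymptoticRatio_le_of_forall
    (N := max 1 (max (N * c + c) ((c * ρ * K + c) / ε))) fun L hL => ?_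
  obtain ⟨h1, h2⟩ := max_le_iff.1 hL
  obtain ⟨h2, h3⟩ := max_le_iff.1 h2
  have hbin : N ≤ binOPT (slipWidths c L) := by
    have h4 := h2.trans (stripOPT_le_binOPT_slipWidths hc L)
    exact le_of_mul_le_mul_right (by linarith) hc0
  have hA := hN _ hbin
  have hrec := (batchAndPack_spec A hc L).2.1
  have hopt := binOPT_slipWidths_le hc hε hε2 L
  rw [div_le_iff₀ hε] at h3
  rw [div_le_iff₀ (by linarith)]
  calc packingHeight (batchAndPack A c L) ≤ (A (slipWidths c L)).numBins * c + c := hrec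
    _ ≤ ρ * binOPT (slipWidths c L) * c + c := by gcongr
    _ ≤ ρ * ((1 + 2 * ε) * (stripOPT L / (c - 1)) + K) * c + c := by gcongr
    _ = ρ * (1 + 2 * ε) * (c / (c - 1)) * stripOPT L + (c * ρ * K + c) := by ring
    _ ≤ _ := by linarith

theorem limsup_stripRatio_batchAndPack_le (A : BinPackingAlgorithm) :
    limsup (fun c : ℝ => stripRatio (batchAndPack A c)) atTop ≤ A.ratio := by
  refine le_of_forall_gt_imp_ge_of_dense fun b hb => ?_
  obtain ⟨ρ, -, hρ, hρb⟩ := ENNReal.lt_iff_exists_real_btwn.1 hb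
  refine le_trans ?_ hρb.le
  have hc : Tendsto (fun c : ℝ => c / (c - 1)) atTop (𝓝 1) := by
    have h1 : Tendsto (fun c : ℝ => 1 + (c - 1)⁻¹) atTop (𝓝 (1 + 0)) :=
      (tendsto_inv_atTop_zero.comp (tendsto_atTop_add_const_right _ (-1) tendsto_id)).const_add 1
    rw [add_zero] at h1
    refine h1.congr' ((eventually_gt_atTop 1).mono fun c hc => ?_)
    have : c - 1 ≠ 0 := by linarith [hc.ne', sub_pos.2 hc]
    field_simp
    ring
  have hstep : ∀ ε : ℝ, 0 < ε → ε ≤ 1 / 2 →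
      limsup (fun c : ℝ => stripRatio (batchAndPack A c)) atTop ≤
        ENNReal.ofReal (ρ * (1 + 2 * ε) + ε) := by
    intro ε hε hε2
    have hlim : Tendsto (fun c : ℝ => ENNReal.ofReal (ρ * (1 + 2 * ε) * (c / (c - 1)) + ε)) atTop
        (𝓝 (ENNReal.ofReal (ρ * (1 + 2 * ε) * 1 + ε))) :=
      ENNReal.tendsto_ofReal ((hc.const_mul _).add_const _)
    rw [mul_one] at hlim
    rw [← hlim.limsup_eq]
    exact limsup_le_limsup ((eventually_gt_atTop 1).mono fun c hc =>
      stripRatio_batchAndPack_le A hc hρ hε hε2)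
  have hlim : Tendsto (fun ε : ℝ => ENNReal.ofReal (ρ * (1 + 2 * ε) + ε)) (𝓝[>] 0)
      (𝓝 (ENNReal.ofReal ρ)) := by
    have h1 : Continuous fun ε : ℝ => ENNReal.ofReal (ρ * (1 + 2 * ε) + ε) :=
      ENNReal.continuous_ofReal.comp (by fun_prop)
    have h2 := h1.tendsto 0
    simp only [mul_zero, add_zero, mul_one] at h2
    exact h2.mono_left nhdsWithin_le_nhds
  refine ge_of_tendsto hlim ?_
  filter_upwards [Ioc_mem_nhdsGT (show (0 : ℝ) < 1 / 2 by norm_num)] with ε hε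
  exact hstep ε hε.1 hε.2

/-- A bad instance of `A` occurs as the list of slip widths of some `L`, up to the order of the
items, and the corresponding strip packing is no better than the bin packing. -/
theorem ratio_le_stripRatio_batchAndPack {A : BinPackingAlgorithm} (hA : A.OrderIndependent)
    {c : ℝ} (hc : 1 < c) : A.ratio ≤ stripRatio (batchAndPack A c) := by
  refine le_of_forall_lt_imp_le_of_dense fun a ha => ?_
  obtain ⟨ρ₁, hρ₁, haρ, hρA⟩ := ENNReal.lt_iff_exists_real_btwn.1 ha
  obtain ⟨ρ, -, hρρ, hρA⟩ := ENNReal.lt_iff_exists_real_btwn.1 hρA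
  have hlt : ρ₁ < ρ := (ENNReal.ofReal_lt_ofReal_iff'.1 hρρ).1
  have hc0 : 0 < c := by linarith
  have hd : 0 < c - 1 := sub_pos.2 hc
  refine haρ.le.trans (le_asymptoticRatio_of_forall_exists fun N => ?_)
  set K := roundingConstant (1 / 2)
  obtain ⟨l, hl, hratio⟩ := exists_lt_cost_div_of_lt_asymptoticRatio hρA
    (max 1 (max (ρ₁ / (ρ - ρ₁)) (2 * max N 1 / (c - 1) + K)))
  obtain ⟨h1, h2⟩ := max_le_iff.1 hl
  obtain ⟨h2, h3⟩ := max_le_iff.1 h2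
  obtain ⟨L, hL0, hL⟩ := exists_slipWidths_perm hc l
  have hopt := binOPT_slipWidths_le hc (show (0 : ℝ) < 1 / 2 by norm_num) le_rfl L
  have hopt' := stripOPT_le_binOPT_slipWidths hc L
  have hcost := (batchAndPack_spec A hc L).2.2 hL0
  rw [hA _ _ hL] at hcost
  rw [binOPT_eq_of_perm hL] at hopt hopt'
  have h4 : max N 1 ≤ stripOPT L := by
    have h5 : 2 * max N 1 / (c - 1) ≤ 2 * stripOPT L / (c - 1) := by
      refine le_of_add_le_add_right ((h3.trans hopt).trans_eq ?_)
      ring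
    have := (div_le_div_iff_of_pos_right hd).1 h5
    linarith
  have hpos : 0 < stripOPT L := zero_lt_one.trans_le ((le_max_right _ _).trans h4)
  refine ⟨L, (le_max_left _ _).trans h4, ?_⟩
  rw [le_div_iff₀ hpos]
  rw [lt_div_iff₀ (by linarith)] at hratio
  rw [div_le_iff₀ (by linarith)] at h2
  calc ρ₁ * stripOPT L ≤ ρ₁ * (binOPT l * c + c) := by gcongr
    _ = (ρ₁ * binOPT l + ρ₁) * c := by ring
    _ ≤ (ρ * binOPT l) * c := by
        gcongr
        linarith
    _ ≤ (A l).numBins * c := by gcongr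
    _ ≤ packingHeight (batchAndPack A c L) := hcost

theorem theorem2 (A : BinPackingAlgorithm) :
    (∀ c : ℝ, 1 < c → ∀ L : List Rect, IsStripPacking L (batchAndPack A c L)) ∧
    limsup (fun c : ℝ => stripRatio (batchAndPack A c)) atTop ≤ A.ratio ∧
    (A.OrderIndependent →
      Tendsto (fun c : ℝ => stripRatio (batchAndPack A c)) atTop (𝓝 A.ratio)) := by
  refine ⟨fun c hc L => (batchAndPack_spec A hc L).1, limsup_stripRatio_batchAndPack_le A,
    fun hA => ?_⟩
  refine tendsto_of_le_liminf_of_limsup_le ?_ (limsup_stripRatio_batchAndPack_le A)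
  exact le_liminf_of_le (by isBoundedDefault)
    ((eventually_gt_atTop 1).mono fun c hc => ratio_le_stripRatio_batchAndPack hA hc)
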